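/- Let $k$ be an algebraically closed field of characteristic $0$ endowed with the trivial absolute value, and let $r\in(0,1)$. Endow the field $k((S))$ of formal Laurent series with the $S$-adic absolute value $\left|\sum_{i\ge N}a_iS^i\right|=r^N$ if $a_N\neq 0$ (and $|0|=0$), and let $\mathcal L_k(k((S)))$ be the $k$-Banach algebra of bounded $k$-linear maps $\varphi:k((S))\to k((S))$, with the operator norm $\|\varphi\|=\sup_{m\neq 0}|\varphi(m)|/|m|$. Let $\mathbb A^{1,\mathrm{an}}_k$ be the Berkovich affine line, i.e. the set of multiplicative non-archimedean seminorms $|\cdot|_x$ on $k[T]$ that restrict to the trivial absolute value on $k$. For such an $x$ let $\mathscr H(x)$ be the completion of the fraction field of $k[T]/\{f : |f|_x=0\}$ with respect to $|\cdot|_x$, and let $T(x)$ be the image of $T$ in $\mathscr H(x)$. For $c\in k$ and $\rho\ge 0$ let $x_{c,\rho}$ be the point given by $\left|\sum_i a_i(T-c)^i\right|=\max_i|a_i|\rho^i$; the point $x_{c,0}$ is identified with $c\in k$. The spectrum $\Sigma_{f,k}(E)$ of an element $f$ of a $k$-Banach algebra $E$ is the set of the points $x\in\mathbb A^{1,\mathrm{an}}_k$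 such that $f\otimes 1-1\otimes T(x)$ is not invertible in $E\,\widehat\otimes_k\,\mathscr H(x)$, the completion of $E\otimes_k\mathscr H(x)$ with respect to the seminorm $\|g\|=\inf\{\max_i\|m_i\|\,\|n_i\| : g=\sum_i m_i\otimes n_i\}$. Then the spectrum of the derivation $S\frac{d}{dS}$, as an element of $\mathcal L_k(k((S)))$, is $$\Sigma_{S\frac{d}{dS},k}\bigl(\mathcal L_k(k((S)))\bigr)=\mathbb Z\cup\{x_{0,1}\}.$$ -/

import Mathlib

open scoped Polynomial NNReal TensorProduct

noncomputable section

namespace BerkovichSpectrum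

/-- The absolute value of the normed field `k` is trivial. -/
class IsTriviallyValued (k : Type*) [NormedField k] : Prop where
  norm_eq_one : ∀ a : k, a ≠ 0 → ‖a‖ = 1

theorem isNonarchimedean_of_isTriviallyValued (k : Type*) [NormedField k] [IsTriviallyValued k] :
    IsNonarchimedean (NormedField.toAbsoluteValue k) := by
  have hle : ∀ a : k, ‖a‖ ≤ 1 := fun a => by
    by_cases h : a = 0
    · simp [h]
    · exact (IsTriviallyValued.norm_eq_one a h).le
  intro a b
  change ‖a + b‖ ≤ max ‖a‖ ‖b‖
  by_cases ha : a = 0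
  · simp [ha]
  · exact (hle _).trans ((IsTriviallyValued.norm_eq_one a ha).ge.trans (le_max_left _ _))

/-! ### The Berkovich affine line -/

section AffineLine

/-- The Berkovich affine line over `k`, as a set: the points are the multiplicative
non-archimedean seminorms on `k[T]` (that is, the valuations on `k[T]` with values in `ℝ≥0`,
possibly with nonzero support) whose restriction to `k` is the absolute value of `k`. -/
@[ext]
structure AffineLine (k : Type*) [NormedField k] where
  /-- the seminorm -/
  seminorm : Valuation k[X] ℝ≥0
  /-- it restricts to the given absolute value on the constants -/
  map_C : ∀ a : k, seminorm (Polynomial.C a) = ‖a‖₊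

variable {k : Type*} [NormedField k]

namespace AffineLine

variable (x : AffineLine k)

/-- The quotient of `k[T]` by the prime ideal `𝔭_x` of the `f` with `|f|_x = 0`. -/
abbrev Quot : Type _ := k[X] ⧸ x.seminorm.supp

/-- The fraction field of `k[T] / 𝔭_x`. -/
abbrev Frac : Type _ := FractionRing x.Quot

/-- The valuation induced by `|·|_x` on `k[T] / 𝔭_x`. -/
def quotVal : Valuation x.Quot ℝ≥0 := x.seminorm.onQuot le_rfl

theorem nonZeroDivisors_le_primeCompl_supp :
    nonZeroDivisors x.Quot ≤ x.quotVal.supp.primeCompl := by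
  intro a ha h
  have hbot : x.quotVal.supp = ⊥ := by
    rw [quotVal, Valuation.supp_quot, Ideal.map_quotient_self]
  rw [hbot] at h
  exact nonZeroDivisors.ne_zero ha h

/-- The valuation induced by `|·|_x` on the fraction field of `k[T] / 𝔭_x`. -/
def fracVal : Valuation x.Frac ℝ≥0 :=
  x.quotVal.extendToLocalization x.nonZeroDivisors_le_primeCompl_supp x.Frac

/-- `fracVal` as a real absolute value. -/
def fracAbs : AbsoluteValue x.Frac ℝ where
  toFun f := (x.fracVal f : ℝ)
  map_mul' f g := by simp
  nonneg' f := NNReal.coe_nonneg _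
  eq_zero' f := by simp
  add_le' f g := by
    have h : x.fracVal (f + g) ≤ x.fracVal f + x.fracVal g :=
      (x.fracVal.map_add f g).trans (max_le le_self_add le_add_self)
    exact_mod_cast h

/-- The completed residue field `ℋ(x)`: the completion of the fraction field of `k[T] / 𝔭_x`. -/
abbrev H : Type _ := x.fracAbs.Completion

/-- The image `T(x)` of the coordinate `T` in `ℋ(x)`. -/
def coord : x.H :=
  ((WithAbs.toAbs x.fracAbs (algebraMap x.Quot x.Frac
    (Ideal.Quotient.mk x.seminorm.supp Polynomial.X)) : WithAbs x.fracAbs) : x.H)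

/-- The value at `f` of the seminorm `∑ aᵢ (T - c)ⁱ ↦ maxᵢ |aᵢ| rⁱ`
(the `aᵢ` are the coefficients of the Taylor expansion of `f` at `c`). -/
def gaussVal (c : k) (r : ℝ≥0) (f : k[X]) : ℝ≥0 :=
  ⟨(Polynomial.taylor c f).gaussNorm (NormedField.toAbsoluteValue k) (r : ℝ),
    Polynomial.gaussNorm_nonneg _ _ r.coe_nonneg⟩

theorem coe_gaussVal (c : k) (r : ℝ≥0) (f : k[X]) : (gaussVal c r f : ℝ) =
    (Polynomial.taylor c f).gaussNorm (NormedField.toAbsoluteValue k) (r : ℝ) := rfl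

theorem gaussVal_C (c : k) (r : ℝ≥0) (a : k) : gaussVal c r (Polynomial.C a) = ‖a‖₊ := by
  apply NNReal.eq
  rw [coe_gaussVal, Polynomial.taylor_C, Polynomial.gaussNorm_C]
  rfl

/-- The point `x_{c,r}`: the seminorm `∑ aᵢ (T - c)ⁱ ↦ maxᵢ |aᵢ| rⁱ`. -/
def gaussPoint [IsTriviallyValued k] (c : k) (r : ℝ≥0) : AffineLine k where
  seminorm :=
    { toFun := gaussVal c r
      map_zero' := by simpa using gaussVal_C c r 0
      map_one' := by simpa using gaussVal_C c r 1
      map_mul' := fun f g => by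
        apply NNReal.eq
        rw [NNReal.coe_mul]
        simp only [coe_gaussVal, Polynomial.taylor_mul]
        rcases eq_or_lt_of_le r.coe_nonneg with h | h
        · simp only [← h, Polynomial.gaussNorm_zero_right, Polynomial.mul_coeff_zero, map_mul]
        · exact Polynomial.gaussNorm_mul (isNonarchimedean_of_isTriviallyValued k) h _ _
      map_add_le_max' := fun f g => by
        apply NNReal.coe_le_coe.1
        refine le_of_le_of_eq ?_ (NNReal.coe_max _ _).symm
        simp only [coe_gaussVal, map_add]
        exact Polynomial.isNonarchimedean_gaussNorm _
          (isNonarchimedean_of_isTriviallyValued k) r.coe_nonneg _ _ }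
  map_C := gaussVal_C c r

end AffineLine

end AffineLine

/-! ### The completed tensor product -/

section Tensor

variable (k A B : Type*) [NormedField k] [SeminormedRing A] [Algebra k A]
  [SeminormedRing B] [Algebra k B]

variable {k A B} in
/-- The tensor seminorm: the infimum of `maxᵢ ‖mᵢ‖ ‖nᵢ‖` over all the finite representations
`f = ∑ᵢ mᵢ ⊗ nᵢ`. -/
def tensorNorm (f : A ⊗[k] B) : ℝ≥0 :=
  sInf {C : ℝ≥0 | ∃ (n : ℕ) (a : Fin n → A) (b : Fin n → B),
    f = ∑ i, a i ⊗ₜ[k] b i ∧ C = Finset.univ.sup fun i => ‖a i‖₊ * ‖b i‖₊}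

section

variable {k A B}

theorem tensorNorm_le {ι : Type*} (s : Finset ι) (a : ι → A) (b : ι → B) {C : ℝ≥0}
    (h : ∀ i ∈ s, ‖a i‖₊ * ‖b i‖₊ ≤ C) : tensorNorm (∑ i ∈ s, a i ⊗ₜ[k] b i) ≤ C := by
  let e := s.equivFin
  have hsum : ∑ i ∈ s, a i ⊗ₜ[k] b i = ∑ j, a (e.symm j) ⊗ₜ[k] b (e.symm j) := by
    rw [e.symm.sum_comp (fun i : s => a i ⊗ₜ[k] b i), Finset.sum_coe_sort s
      (fun i => a i ⊗ₜ[k] b i)]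
  have hle : (Finset.univ.sup fun j => ‖a (e.symm j)‖₊ * ‖b (e.symm j)‖₊) ≤ C :=
    Finset.sup_le fun j _ => h _ (e.symm j).2
  unfold tensorNorm
  exact csInf_le_of_le (OrderBot.bddBelow _)
    ⟨s.card, fun j => a (e.symm j), fun j => b (e.symm j), hsum, rfl⟩ hle

theorem exists_rep_lt (f : A ⊗[k] B) {ε : ℝ≥0} (hε : tensorNorm f < ε) :
    ∃ (n : ℕ) (a : Fin n → A) (b : Fin n → B),
      f = ∑ i, a i ⊗ₜ[k] b i ∧ ∀ i, ‖a i‖₊ * ‖b i‖₊ ≤ ε := by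
  have hne : {C : ℝ≥0 | ∃ (n : ℕ) (a : Fin n → A) (b : Fin n → B),
    f = ∑ i, a i ⊗ₜ[k] b i ∧ C = Finset.univ.sup fun i => ‖a i‖₊ * ‖b i‖₊}.Nonempty := by
    obtain ⟨s, hs⟩ := TensorProduct.exists_finset f
    let e := s.equivFin
    refine ⟨_, s.card, fun j => (e.symm j).1.1, fun j => (e.symm j).1.2, ?_, rfl⟩
    rw [e.symm.sum_comp (fun i : s => i.1.1 ⊗ₜ[k] i.1.2), Finset.sum_coe_sort s
      (fun i => i.1 ⊗ₜ[k] i.2), hs]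
  obtain ⟨C, ⟨n, a, b, hf, hC⟩, hlt⟩ := exists_lt_of_csInf_lt hne hε
  exact ⟨n, a, b, hf, fun i => (Finset.le_sup (f := fun i => ‖a i‖₊ * ‖b i‖₊)
    (Finset.mem_univ i)).trans (hC ▸ hlt.le)⟩

theorem tensorNorm_zero : tensorNorm (0 : A ⊗[k] B) = 0 := by
  have := tensorNorm_le (k := k) (A := A) (B := B) (∅ : Finset ℕ) (fun _ => 0) (fun _ => 0)
    (C := 0) (by simp)
  simpa using this

theorem tensorNorm_neg_le (f : A ⊗[k] B) : tensorNorm (-f) ≤ tensorNorm f := by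
  refine le_of_forall_gt_imp_ge_of_dense fun ε hε => ?_
  obtain ⟨n, a, b, rfl, h⟩ := exists_rep_lt f hε
  rw [← Finset.sum_neg_distrib]
  simp_rw [← TensorProduct.neg_tmul]
  exact tensorNorm_le _ _ _ fun i _ => by simpa using h i

theorem tensorNorm_add_le_max (f g : A ⊗[k] B) :
    tensorNorm (f + g) ≤ max (tensorNorm f) (tensorNorm g) := by
  refine le_of_forall_gt_imp_ge_of_dense fun ε hε => ?_
  obtain ⟨n, a, b, rfl, h⟩ := exists_rep_lt f ((le_max_left _ _).trans_lt hε)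
  obtain ⟨n', a', b', rfl, h'⟩ := exists_rep_lt g ((le_max_right _ _).trans_lt hε)
  have := tensorNorm_le (k := k) (Finset.univ : Finset (Fin n ⊕ Fin n')) (Sum.elim a a')
    (Sum.elim b b') (C := ε) (by rintro (i | i) _ <;> simp [h, h'])
  simpa using this

theorem tensorNorm_mul_le (f g : A ⊗[k] B) :
    tensorNorm (f * g) ≤ tensorNorm f * tensorNorm g := by
  rw [← NNReal.coe_le_coe, NNReal.coe_mul]
  refine le_mul_of_forall_lt₀ fun C' hC D' hD => ?_
  lift C' to ℝ≥0 using (NNReal.coe_nonneg _).trans hC.le with C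
  lift D' to ℝ≥0 using (NNReal.coe_nonneg _).trans hD.le with D
  rw [gt_iff_lt, NNReal.coe_lt_coe] at hC hD
  rw [← NNReal.coe_mul, NNReal.coe_le_coe]
  obtain ⟨n, a, b, rfl, h⟩ := exists_rep_lt f hC
  obtain ⟨n', a', b', rfl, h'⟩ := exists_rep_lt g hD
  rw [Finset.sum_mul_sum, ← Finset.sum_product']
  simp_rw [Algebra.TensorProduct.tmul_mul_tmul]
  refine tensorNorm_le _ _ _ fun i _ => ?_
  calc ‖a i.1 * a' i.2‖₊ * ‖b i.1 * b' i.2‖₊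
      ≤ (‖a i.1‖₊ * ‖a' i.2‖₊) * (‖b i.1‖₊ * ‖b' i.2‖₊) := by
        gcongr <;> exact nnnorm_mul_le _ _
    _ = (‖a i.1‖₊ * ‖b i.1‖₊) * (‖a' i.2‖₊ * ‖b' i.2‖₊) := by ring
    _ ≤ C * D := by gcongr <;> simp [h, h']

end

/-- The algebra `A ⊗[k] B`, carrying the tensor seminorm. -/
def NTensor : Type _ := A ⊗[k] B

instance : Ring (NTensor k A B) := inferInstanceAs (Ring (A ⊗[k] B))

/-- The identity map, to the tensor product carrying its seminorm. -/
def toNTensor : A ⊗[k] B ≃+* NTensor k A B := RingEquiv.refl (A ⊗[k] B)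

/-- The tensor seminorm as a ring seminorm. -/
def tensorRingSeminorm : RingSeminorm (NTensor k A B) where
  toFun f := (tensorNorm (k := k) (A := A) (B := B) f : ℝ)
  map_zero' := by exact_mod_cast tensorNorm_zero (k := k) (A := A) (B := B)
  add_le' f g := by
    exact_mod_cast (tensorNorm_add_le_max (k := k) (A := A) (B := B) f g).trans
      (max_le le_self_add le_add_self)
  neg' f := by
    refine congrArg NNReal.toReal (le_antisymm (tensorNorm_neg_le (A := A) (B := B) f) ?_)
    exact (congrArg tensorNorm (neg_neg (show A ⊗[k] B from f))).symm.trans_le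
      (tensorNorm_neg_le (k := k) (A := A) (B := B) (-f))
  mul_le' f g := by exact_mod_cast tensorNorm_mul_le (k := k) (A := A) (B := B) f g

instance : SeminormedRing (NTensor k A B) := (tensorRingSeminorm k A B).toSeminormedRing

/-- The completed tensor product of `A` and `B` over `k`. -/
abbrev CTensor : Type _ := UniformSpace.Completion (NTensor k A B)

variable {A B}

/-- The image of `a ⊗ b` in the completed tensor product. -/
def ctmul (a : A) (b : B) : CTensor k A B :=
  UniformSpace.Completion.coe' (toNTensor k A B (a ⊗ₜ[k] b))

end Tensor

/-! ### The spectrum -/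

/-- The spectrum (in the sense of Berkovich) of an element `f` of a normed `k`-algebra `E`: the
set of the points `x` of the affine line for which `f ⊗ 1 - 1 ⊗ T(x)` is not invertible in the
completed tensor product of `E` and `ℋ(x)` over `k`. -/
def berkovichSpectrum (k : Type*) [NormedField k] {E : Type*} [SeminormedRing E] [Algebra k E]
    (f : E) : Set (AffineLine k) :=
  {x | ¬ IsUnit (ctmul k f (1 : x.H) - ctmul k (1 : E) x.coord)}

/-! ### Bounded operators -/

section Bounded

variable (k V : Type*) [NormedField k] [NormedAddCommGroup V] [NormedSpace k V]

/-- The algebra of the bounded `k`-linear maps `V → V`. (Over a trivially valued field this may be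
smaller than the algebra of the continuous ones.) -/
def boundedEnd : Subalgebra k (Module.End k V) where
  carrier := {φ | ∃ C : ℝ, 0 ≤ C ∧ ∀ m, ‖φ m‖ ≤ C * ‖m‖}
  mul_mem' := by
    rintro φ ψ ⟨C, hC, h⟩ ⟨D, hD, h'⟩
    refine ⟨C * D, mul_nonneg hC hD, fun m => (h (ψ m)).trans ?_⟩
    rw [mul_assoc]
    exact mul_le_mul_of_nonneg_left (h' m) hC
  add_mem' := by
    rintro φ ψ ⟨C, hC, h⟩ ⟨D, hD, h'⟩
    refine ⟨C + D, add_nonneg hC hD, fun m => (norm_add_le _ _).trans ?_⟩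
    rw [add_mul]
    exact add_le_add (h m) (h' m)
  algebraMap_mem' a := ⟨‖a‖, norm_nonneg _, fun m => by
    rw [Module.algebraMap_end_apply]; exact norm_smul_le _ _⟩

/-- The type of bounded operators on `V`. -/
abbrev BoundedEnd : Type _ := boundedEnd k V

variable {k V}

/-- The operator norm `sup_{m ≠ 0} ‖φ m‖ / ‖m‖` (the quotient is `0` for `m = 0`). -/
def opNorm (φ : BoundedEnd k V) : ℝ := ⨆ m : V, ‖φ.1 m‖ / ‖m‖

theorem le_opNorm (φ : BoundedEnd k V) (m : V) : ‖φ.1 m‖ ≤ opNorm φ * ‖m‖ := by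
  obtain ⟨C, hC, h⟩ := φ.2
  rcases (norm_nonneg m).eq_or_lt with hm | hm
  · have := h m
    rw [← hm] at this ⊢
    simpa using this
  · rw [← div_le_iff₀ hm]
    refine le_ciSup (f := fun m : V => ‖φ.1 m‖ / ‖m‖) ⟨C, ?_⟩ m
    rintro _ ⟨x, rfl⟩
    exact div_le_of_le_mul₀ (norm_nonneg _) hC (h x)

theorem opNorm_nonneg (φ : BoundedEnd k V) : 0 ≤ opNorm φ :=
  Real.iSup_nonneg fun _ => by positivity

theorem opNorm_le (φ : BoundedEnd k V) {C : ℝ} (hC : 0 ≤ C) (h : ∀ m, ‖φ.1 m‖ ≤ C * ‖m‖) :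
    opNorm φ ≤ C :=
  Real.iSup_le (fun m => div_le_of_le_mul₀ (norm_nonneg _) hC (h m)) hC

variable (k V) in
/-- The operator norm as a ring norm. -/
def opRingNorm : RingNorm (BoundedEnd k V) where
  toFun := opNorm
  map_zero' := le_antisymm (opNorm_le _ le_rfl fun m => by simp) (opNorm_nonneg _)
  add_le' φ ψ := opNorm_le _ (add_nonneg (opNorm_nonneg _) (opNorm_nonneg _)) fun m =>
    (norm_add_le (φ.1 m) (ψ.1 m)).trans <| by
      rw [add_mul]; exact add_le_add (le_opNorm φ m) (le_opNorm ψ m)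
  neg' φ := by simp [opNorm]
  mul_le' φ ψ := opNorm_le _ (mul_nonneg (opNorm_nonneg _) (opNorm_nonneg _)) fun m =>
    (le_opNorm φ (ψ.1 m)).trans <| by
      rw [mul_assoc]; exact mul_le_mul_of_nonneg_left (le_opNorm ψ m) (opNorm_nonneg _)
  eq_zero_of_map_eq_zero' φ h := by
    ext m
    have := le_opNorm φ m
    rw [h, zero_mul] at this
    exact norm_le_zero_iff.1 this

instance : NormedRing (BoundedEnd k V) := (opRingNorm k V).toNormedRing

end Bounded

/-! ### Laurent series and the derivation `S d/dS` -/

section Laurent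

/-- The field `k((S))`, to be endowed with the `S`-adic absolute value for which `|S| = r`. -/
def Laurent (k : Type*) [Field k] (_r : Set.Ioo (0 : ℝ) 1) : Type _ := LaurentSeries k

variable {k : Type*} [NormedField k] (r : Set.Ioo (0 : ℝ) 1)

open Classical in
/-- The absolute value `|∑_{i ≥ N} aᵢ Sⁱ| = r ^ N` if `a_N ≠ 0`, and `|0| = 0`. -/
def laurentAbs (f : LaurentSeries k) : ℝ := if f = 0 then 0 else (r : ℝ) ^ f.order

theorem laurentAbs_nonneg (f : LaurentSeries k) : 0 ≤ laurentAbs r f := by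
  unfold laurentAbs
  split_ifs
  · exact le_rfl
  · exact (zpow_pos r.2.1 _).le

theorem laurentAbs_le_of_coeff (f g : LaurentSeries k)
    (h : ∀ n, f.coeff n = 0 → g.coeff n = 0) : laurentAbs r g ≤ laurentAbs r f := by
  by_cases hg : g = 0
  · subst hg
    rw [show laurentAbs r (0 : LaurentSeries k) = 0 by simp [laurentAbs]]
    exact laurentAbs_nonneg r f
  · have hgo : f.coeff g.order ≠ 0 := fun h0 =>
      HahnSeries.coeff_order_eq_zero.not.2 hg (h _ h0)
    have hf : f ≠ 0 := by rintro rfl; simp at hgo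
    simp only [laurentAbs, hf, hg, if_false]
    exact zpow_le_zpow_right_of_le_one₀ r.2.1 r.2.2.le (HahnSeries.order_le_of_coeff_ne_zero hgo)

/-- The `S`-adic absolute value as a norm of abelian groups. -/
def laurentNorm : AddGroupNorm (LaurentSeries k) where
  toFun := laurentAbs r
  map_zero' := by simp [laurentAbs]
  add_le' f g := by
    by_cases hf : f = 0
    · rw [hf, zero_add]; linarith [laurentAbs_nonneg r (0 : LaurentSeries k)]
    by_cases hg : g = 0
    · rw [hg, add_zero]; linarith [laurentAbs_nonneg r (0 : LaurentSeries k)]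
    by_cases hfg : f + g = 0
    · have h0 : laurentAbs r (f + g) = 0 := by simp [laurentAbs, hfg]
      rw [h0]
      exact add_nonneg (laurentAbs_nonneg r f) (laurentAbs_nonneg r g)
    have hmin := HahnSeries.min_order_le_order_add hfg
    simp only [laurentAbs, hf, hg, hfg, if_false]
    have hp := fun n : ℤ => (zpow_pos r.2.1 n).le
    refine (zpow_le_zpow_right_of_le_one₀ r.2.1 r.2.2.le hmin).trans ?_
    rcases min_choice f.order g.order with h | h <;> rw [h] <;>
      linarith [hp f.order, hp g.order]
  neg' f := le_antisymm (laurentAbs_le_of_coeff r _ _ fun n h => by simp [h])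
    (laurentAbs_le_of_coeff r _ _ fun n h => by simpa using h)
  eq_zero_of_map_eq_zero' f h := by
    by_contra hf
    simp only [laurentAbs, hf, if_false] at h
    exact (zpow_pos r.2.1 _).ne' h

instance : NormedAddCommGroup (Laurent k r) := (laurentNorm (k := k) r).toNormedAddCommGroup

instance : Module k (Laurent k r) := inferInstanceAs (Module k (LaurentSeries k))

variable (k) in
/-- The identity map, from the normed space `k((S))` to the Laurent series. -/
def toSeries : Laurent k r ≃ₗ[k] LaurentSeries k where
  toFun f := f
  invFun f := f
  left_inv _ := rfl
  right_inv _ := rfl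
  map_add' _ _ := rfl
  map_smul' _ _ := rfl

theorem norm_laurent_def (f : Laurent k r) : ‖f‖ = laurentAbs r (toSeries k r f) := rfl

instance [IsTriviallyValued k] : NormedSpace k (Laurent k r) where
  norm_smul_le a f := by
    by_cases ha : a = 0
    · rw [ha, zero_smul, norm_zero, norm_zero, zero_mul]
    · rw [IsTriviallyValued.norm_eq_one a ha, one_mul, norm_laurent_def, norm_laurent_def, map_smul]
      exact laurentAbs_le_of_coeff r _ _ fun n h => by rw [HahnSeries.coeff_smul, h, smul_zero]

variable (k) in
/-- The derivation `S d/dS` of `k((S))`, as a `k`-linear map. -/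
def sddsLin : Module.End k (LaurentSeries k) where
  toFun f := HahnSeries.single 1 1 * LaurentSeries.derivative k f
  map_add' f g := by rw [map_add, mul_add]
  map_smul' a f := by 
    rw [map_smul, ← HahnSeries.C_mul_eq_smul, ← HahnSeries.C_mul_eq_smul, RingHom.id_apply,
      mul_left_comm]

theorem coeff_sddsLin (f : LaurentSeries k) (n : ℤ) :
    (sddsLin k f).coeff n = (n : k) * f.coeff n := by
  have h := HahnSeries.coeff_single_mul_add (r := (1 : k)) (x := LaurentSeries.derivative k f)
    (a := n - 1) (b := 1)
  rw [sub_add_cancel] at h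
  change (HahnSeries.single 1 1 * LaurentSeries.derivative k f).coeff n = _
  rw [h, LaurentSeries.derivative_apply, LaurentSeries.hasseDeriv_coeff]
  simp

variable (k) in
/-- The derivation `S d/dS` as a bounded operator on the normed space `k((S))`. -/
def sdds [IsTriviallyValued k] : BoundedEnd k (Laurent k r) :=
  ⟨(toSeries k r).symm.toLinearMap ∘ₗ sddsLin k ∘ₗ (toSeries k r).toLinearMap, 1, zero_le_one,
    fun f => by
      rw [one_mul, norm_laurent_def, norm_laurent_def]
      refine laurentAbs_le_of_coeff r _ _ fun n h => ?_
      change (sddsLin k (toSeries k r f)).coeff n = 0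
      rw [coeff_sddsLin, h, mul_zero]⟩

end Laurent

end BerkovichSpectrum

end

open scoped Polynomial NNReal TensorProduct

noncomputable section

namespace BerkovichSpectrum

/-! ### Points of the affine line -/

namespace AffineLine

section

variable {k : Type*} [NormedField k]

/-! The operator $S\,d/dS$ is diagonal: it multiplies the coefficient of $S^n$ by $n$. The norm of
$k((S))$ depends only on the order, so every diagonal operator has norm at most $1$, whatever its
entries (`norm_diag_le`).

Points outside the spectrum come from Neumann series. If $|T|_x>1$, one expands in $T(x)^{-1}$. If
$|T-a|_x<1$ with $a\notin\mathbb Z$, then $S\,d/dS-a$ has a diagonal inverse of norm at most $1$ and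
one expands in $T(x)-a$. If $0<|T-m|_x<1$ with $m\in\mathbb Z$, the line $kS^m$ is split off by an
idempotent: there the element acts as the unit $-(T(x)-m)$, and on the complement the previous
argument applies (`isUnit_ctmul_sub_of_idempotent`). As $k$ is algebraically closed, a point is
determined by the values $|T-a|_x$, so only the integers and $x_{0,1}$ remain.

Conversely, the diagonal matrix coefficients $\ell_n$ are contractions to $k$ that turn
$S\,d/dS\otimes 1-1\otimes T(x)$ into multiplication by $n-T(x)$. An inverse would yield one $f$ in
the uncompleted tensor product with $|(n-T(x))\,\ell_n(f)-1|<1$ for all $n$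
(`exists_forall_norm_lt_one`). At $x=n$ this is absurd. At $x_{0,1}$ the field $\mathscr H(x)$ is
trivially valued, so $\ell_n(f)=(n-T(x))^{-1}$ exactly; but $f$ is a finite sum, so these infinitely
many linearly independent elements would lie in a finite-dimensional space. -/

/-- Every polynomial is a constant times a product of linear factors, and seminorms of points are
multiplicative. -/
theorem ext_of_X_sub_C [IsAlgClosed k] {x y : AffineLine k}
    (h : ∀ a : k, x.seminorm (Polynomial.X - Polynomial.C a) =
      y.seminorm (Polynomial.X - Polynomial.C a)) : x = y := by
  refine AffineLine.ext (Valuation.ext fun p => ?_)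
  rw [(IsAlgClosed.splits p).eq_prod_roots]
  simp only [map_mul, map_C, map_multiset_prod, Multiset.map_map, Function.comp_def, h]

theorem seminorm_X_sub_C_le_max (x : AffineLine k) (a b : k) :
    x.seminorm (Polynomial.X - Polynomial.C a) ≤
      max (x.seminorm (Polynomial.X - Polynomial.C b)) ‖b - a‖₊ := by
  rw [← x.map_C (b - a)]
  convert x.seminorm.map_add (Polynomial.X - Polynomial.C b) (Polynomial.C (b - a)) using 2
  rw [Polynomial.C_sub]
  ring

theorem seminorm_X_sub_C_of_lt (x : AffineLine k) {a b : k}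
    (h : x.seminorm (Polynomial.X - Polynomial.C b) < ‖b - a‖₊) :
    x.seminorm (Polynomial.X - Polynomial.C a) = ‖b - a‖₊ := by
  rw [← x.map_C] at h ⊢
  convert x.seminorm.map_add_eq_of_lt_left h using 2
  rw [Polynomial.C_sub]
  ring

theorem seminorm_X_sub_C_le_one [IsTriviallyValued k] (x : AffineLine k)
    (h : x.seminorm Polynomial.X ≤ 1) (a : k) :
    x.seminorm (Polynomial.X - Polynomial.C a) ≤ 1 := by
  refine (x.seminorm_X_sub_C_le_max a 0).trans (max_le (by simpa using h) ?_)
  by_cases ha : a = 0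
  · simp [ha]
  · refine NNReal.coe_le_coe.1 ?_
    simpa using (IsTriviallyValued.norm_eq_one a ha).le

theorem gaussPoint_apply [IsTriviallyValued k] (c : k) (r : ℝ≥0) (p : k[X]) :
    (gaussPoint c r).seminorm p = gaussVal c r p := rfl

theorem gaussPoint_zero_one_X_sub_C [IsTriviallyValued k] (a : k) :
    (gaussPoint (0 : k) 1).seminorm (Polynomial.X - Polynomial.C a) = 1 := by
  refine le_antisymm (seminorm_X_sub_C_le_one _ ?_ a) ?_
  · rw [gaussPoint_apply, ← NNReal.coe_le_coe, coe_gaussVal, Polynomial.taylor_zero,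
      ← Polynomial.monomial_one_one_eq_X, Polynomial.gaussNorm_monomial]
    simp
  · rw [gaussPoint_apply, ← NNReal.coe_le_coe, coe_gaussVal, Polynomial.taylor_zero]
    refine le_of_eq_of_le ?_ (Polynomial.le_gaussNorm _ _ (NNReal.coe_nonneg _) 1)
    simp

theorem gaussPoint_zero_right_apply [IsTriviallyValued k] (c : k) (p : k[X]) :
    (gaussPoint c 0).seminorm p = ‖p.eval c‖₊ := by
  rw [gaussPoint_apply]
  apply NNReal.eq
  rw [coe_gaussVal, NNReal.coe_zero, Polynomial.gaussNorm_zero_right, Polynomial.taylor_coeff_zero]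
  rfl

theorem eq_gaussPoint_zero_one [IsTriviallyValued k] [IsAlgClosed k] {x : AffineLine k}
    (h : ∀ a : k, x.seminorm (Polynomial.X - Polynomial.C a) = 1) : x = gaussPoint 0 1 :=
  ext_of_X_sub_C fun a => by rw [h, gaussPoint_zero_one_X_sub_C]

theorem eq_gaussPoint_zero_right [IsTriviallyValued k] [IsAlgClosed k] {x : AffineLine k} {c : k}
    (h : x.seminorm (Polynomial.X - Polynomial.C c) = 0) : x = gaussPoint c 0 := by
  refine ext_of_X_sub_C fun a => ?_
  have he : (gaussPoint c 0).seminorm (Polynomial.X - Polynomial.C a) = ‖c - a‖₊ := by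
    simp [gaussPoint_zero_right_apply]
  rw [he]
  by_cases hca : c = a
  · subst hca; simp [h]
  · exact x.seminorm_X_sub_C_of_lt (by simpa [h, sub_eq_zero] using hca)

theorem gaussPoint_zero_one_of_ne_zero [IsTriviallyValued k] [IsAlgClosed k] {p : k[X]}
    (hp : p ≠ 0) : (gaussPoint (0 : k) 1).seminorm p = 1 := by
  rw [(IsAlgClosed.splits p).eq_prod_roots]
  have hl : ‖p.leadingCoeff‖₊ = 1 :=
    NNReal.eq (IsTriviallyValued.norm_eq_one _ (Polynomial.leadingCoeff_ne_zero.2 hp))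
  simp only [map_mul, map_C, map_multiset_prod, Multiset.map_map, Function.comp_def,
    gaussPoint_zero_one_X_sub_C, hl]
  simp

end

/-! ### The completed residue field -/

section

variable {k : Type*} [NormedField k] (x : AffineLine k)

/-- The map `Frac(k[T] / 𝔭_x) → ℋ(x)`. -/
def ofFrac : x.Frac →+* x.H :=
  (UniformSpace.Completion.coeRingHom (α := WithAbs x.fracAbs)).comp
    (WithAbs.equiv x.fracAbs).symm.toRingHom

theorem norm_ofFrac (f : x.Frac) : ‖x.ofFrac f‖ = x.fracVal f :=
  UniformSpace.Completion.norm_coe (E := WithAbs x.fracAbs) _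

theorem denseRange_ofFrac : DenseRange x.ofFrac := by
  intro h
  have := UniformSpace.Completion.denseRange_coe (α := WithAbs x.fracAbs) h
  refine closure_mono ?_ this
  rintro _ ⟨f, rfl⟩
  exact ⟨WithAbs.equiv _ f, rfl⟩

theorem fracVal_algebraMap (p : k[X]) :
    x.fracVal (algebraMap x.Quot x.Frac (Ideal.Quotient.mk _ p)) = x.seminorm p := by
  rw [fracVal, Valuation.extendToLocalization_apply_map_apply]
  rfl

theorem aeval_coord (p : k[X]) : Polynomial.aeval x.coord p =
    x.ofFrac (algebraMap x.Quot x.Frac (Ideal.Quotient.mk _ p)) := by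
  have h : (Polynomial.aeval x.coord : k[X] →ₐ[k] x.H).toRingHom =
      x.ofFrac.comp ((algebraMap x.Quot x.Frac).comp (Ideal.Quotient.mk _)) := by
    refine Polynomial.ringHom_ext (fun a => ?_) ?_
    · exact (Polynomial.aeval_C x.coord a).trans rfl
    · exact (Polynomial.aeval_X x.coord).trans rfl
  exact RingHom.congr_fun h p

theorem norm_aeval_coord (p : k[X]) : ‖Polynomial.aeval x.coord p‖ = x.seminorm p := by
  rw [aeval_coord, norm_ofFrac, fracVal_algebraMap]

theorem norm_coord_sub (a : k) :
    ‖x.coord - algebraMap k x.H a‖ = x.seminorm (Polynomial.X - Polynomial.C a) := by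
  simp [← norm_aeval_coord]

theorem norm_coord : ‖x.coord‖ = x.seminorm Polynomial.X := by
  simp [← norm_aeval_coord]

theorem norm_smul_H (a : k) (h : x.H) : ‖a • h‖ = ‖a‖ * ‖h‖ := by
  rw [Algebra.smul_def, norm_mul, ← Polynomial.aeval_C x.coord, norm_aeval_coord, map_C, coe_nnnorm]

instance : IsUltrametricDist x.H := by
  refine IsUltrametricDist.isUltrametricDist_of_forall_norm_add_le_max_norm fun a b => ?_
  refine x.denseRange_ofFrac.induction_on₂
    (p := fun a b => ‖a + b‖ ≤ max ‖a‖ ‖b‖) ?_ (fun f g => ?_) a b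
  · exact isClosed_le (by fun_prop) (by fun_prop)
  · rw [← RingHom.map_add, norm_ofFrac, norm_ofFrac, norm_ofFrac]
    exact_mod_cast x.fracVal.map_add f g

/-- The fraction field is trivially valued, hence discrete, and completing it adds no small
elements. This turns the approximate identities at the Gauss point into exact ones. -/
theorem eq_zero_of_norm_lt_one (hx : ∀ p, x.seminorm p = 0 ∨ x.seminorm p = 1) {h : x.H}
    (hh : ‖h‖ < 1) : h = 0 := by
  by_contra h0
  have hpos : 0 < ‖h‖ := norm_pos_iff.2 h0
  obtain ⟨f, hf⟩ := x.denseRange_ofFrac.exists_dist_lt h hpos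
  rw [dist_eq_norm] at hf
  -- An approximant closer to `h` than `‖h‖` also has norm below $1$, so it vanishes; then `h` is at
  -- distance less than `‖h‖` from $0$.
  have hle : ‖x.ofFrac f‖ < 1 := by
    refine lt_of_le_of_lt ?_ hh
    rw [show x.ofFrac f = h + -(h - x.ofFrac f) by abel]
    exact (IsUltrametricDist.norm_add_le_max _ _).trans
      (max_le le_rfl (by rw [norm_neg]; exact hf.le))
  have hval : ∀ q : x.Quot, x.fracVal (algebraMap x.Quot x.Frac q) = 0 ∨
      x.fracVal (algebraMap x.Quot x.Frac q) = 1 := fun q => by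
    obtain ⟨p, rfl⟩ := Ideal.Quotient.mk_surjective q
    rw [fracVal_algebraMap]
    exact hx p
  obtain ⟨p, q, -, rfl⟩ := IsFractionRing.div_surjective (A := x.Quot) f
  have hz : ‖x.ofFrac (algebraMap x.Quot x.Frac p / algebraMap x.Quot x.Frac q)‖ = 0 := by
    rw [norm_ofFrac, map_div₀] at hle ⊢
    -- If `q` has value $0$, the convention $z/0=0$ settles the case.
    rcases hval p with hp | hp <;> rcases hval q with hq | hq <;> simp [hp, hq] at hle ⊢
  rw [norm_eq_zero.1 hz, sub_zero] at hf
  exact lt_irrefl _ hf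

theorem transcendental_coord (hx : ∀ p ≠ 0, x.seminorm p ≠ 0) : Transcendental k x.coord := by
  rw [transcendental_iff]
  intro p hp
  by_contra h
  apply hx p h
  rw [← NNReal.coe_eq_zero, ← norm_aeval_coord, hp, norm_zero]

end

end AffineLine

/-! ### Units in the completed tensor product -/

section Tensor

variable {k A B : Type*} [NormedField k] [SeminormedRing A] [Algebra k A]
  [SeminormedRing B] [Algebra k B]

theorem norm_toNTensor (f : A ⊗[k] B) : ‖toNTensor k A B f‖ = tensorNorm f := rfl

theorem ctmul_mul (a a' : A) (b b' : B) :
    ctmul k a b * ctmul k a' b' = ctmul k (a * a') (b * b') := by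
  rw [ctmul, ctmul, ctmul, ← UniformSpace.Completion.coe_mul, ← map_mul,
    Algebra.TensorProduct.tmul_mul_tmul]

theorem ctmul_add_left (a a' : A) (b : B) :
    ctmul k (a + a') b = ctmul k a b + ctmul k a' b := by
  rw [ctmul, ctmul, ctmul, ← UniformSpace.Completion.coe_add, ← map_add, TensorProduct.add_tmul]

theorem ctmul_add_right (a : A) (b b' : B) :
    ctmul k a (b + b') = ctmul k a b + ctmul k a b' := by
  rw [ctmul, ctmul, ctmul, ← UniformSpace.Completion.coe_add, ← map_add, TensorProduct.tmul_add]

theorem ctmul_one_one : ctmul k (1 : A) (1 : B) = 1 := by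
  rw [ctmul, ← Algebra.TensorProduct.one_def, map_one]
  rfl

theorem ctmul_algebraMap (a : k) :
    ctmul k (algebraMap k A a) (1 : B) = ctmul k (1 : A) (algebraMap k B a) := by
  rw [ctmul, ctmul, Algebra.algebraMap_eq_smul_one, Algebra.algebraMap_eq_smul_one,
    TensorProduct.smul_tmul]

/-- Constants pass through the tensor sign, so the coordinate can be recentred at `a`, where
$T(x)-a$ is small. -/
theorem ctmul_sub_ctmul_translate (f : A) (t : B) (a : k) :
    ctmul k f (1 : B) - ctmul k (1 : A) t =
      ctmul k (f - algebraMap k A a) (1 : B) - ctmul k (1 : A) (t - algebraMap k B a) := by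
  have h₁ := ctmul_add_left (k := k) (f - algebraMap k A a) (algebraMap k A a) (1 : B)
  have h₂ := ctmul_add_right (k := k) (1 : A) (t - algebraMap k B a) (algebraMap k B a)
  rw [sub_add_cancel] at h₁ h₂
  rw [h₁, h₂, ctmul_algebraMap]
  abel

theorem norm_ctmul_le (a : A) (b : B) : ‖ctmul k a b‖ ≤ ‖a‖ * ‖b‖ := by
  rw [ctmul, UniformSpace.Completion.norm_coe, norm_toNTensor]
  have h := tensorNorm_le (k := k) {()} (fun _ => a) (fun _ => b) (C := ‖a‖₊ * ‖b‖₊) (by simp)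
  rw [Finset.sum_singleton] at h
  exact_mod_cast h

theorem isUnit_ctmul_left {g g' : A} (h : g * g' = 1) (h' : g' * g = 1) :
    IsUnit (ctmul k g (1 : B)) :=
  ⟨⟨ctmul k g 1, ctmul k g' 1, by rw [ctmul_mul, h, one_mul, ctmul_one_one],
    by rw [ctmul_mul, h', one_mul, ctmul_one_one]⟩, rfl⟩

theorem isUnit_ctmul_right {t t' : B} (h : t * t' = 1) (h' : t' * t = 1) :
    IsUnit (ctmul k (1 : A) t) :=
  ⟨⟨ctmul k 1 t, ctmul k 1 t', by rw [ctmul_mul, h, one_mul, ctmul_one_one],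
    by rw [ctmul_mul, h', one_mul, ctmul_one_one]⟩, rfl⟩

/-- Factoring out $g\otimes1$ leaves $1-g'\otimes t$, inverted by a geometric series in the
completion. -/
theorem isUnit_ctmul_sub_of_left {g g' : A} {t : B} (h : g * g' = 1) (h' : g' * g = 1)
    (ht : ‖g'‖ * ‖t‖ < 1) : IsUnit (ctmul k g (1 : B) - ctmul k (1 : A) t) := by
  have hg : IsUnit (ctmul k g (1 : B)) := isUnit_ctmul_left h h'
  have hu : ctmul k g (1 : B) - ctmul k (1 : A) t = ctmul k g 1 * (1 - ctmul k g' t) := by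
    simp [mul_sub, ctmul_mul, h]
  rw [hu]
  exact hg.mul (isUnit_one_sub_of_norm_lt_one ((norm_ctmul_le _ _).trans_lt ht))

theorem isUnit_ctmul_sub_of_right {g : A} {t t' : B} (h : t * t' = 1) (h' : t' * t = 1)
    (ht : ‖g‖ * ‖t'‖ < 1) : IsUnit (ctmul k g (1 : B) - ctmul k (1 : A) t) := by
  have hg : IsUnit (ctmul k (1 : A) t) := isUnit_ctmul_right h h'
  have hu : ctmul k g (1 : B) - ctmul k (1 : A) t = -(ctmul k 1 t * (1 - ctmul k g t')) := by
    simp [mul_sub, ctmul_mul, h]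
  rw [hu]
  exact (hg.mul (isUnit_one_sub_of_norm_lt_one ((norm_ctmul_le _ _).trans_lt ht))).neg

/-- The idempotent splits the problem into two blocks, and the inverses `s⁻¹` and `z⁻¹` are glued
along `e` and `1 - e`. -/
theorem isUnit_of_isIdempotentElem {R : Type*} [Ring R] {e s z : R} (he : IsIdempotentElem e)
    (hs : IsUnit s) (hz : IsUnit z) (hes : Commute e s) (hez : Commute e z) :
    IsUnit (e * s + (1 - e) * z) := by
  obtain ⟨s, rfl⟩ := hs
  obtain ⟨z, rfl⟩ := hz
  -- Quantifying over the units lets the same identity, applied to their inverses, give the other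
  -- one-sided inverse.
  have key : ∀ s z : Rˣ, Commute e s → Commute e z →
      (e * s + (1 - e) * z) * (e * ↑s⁻¹ + (1 - e) * ↑z⁻¹) = 1 := fun s z hs hz => by
    have h₁ : e * s * (e * ↑s⁻¹) = e := by
      rw [hs.eq, mul_assoc, ← mul_assoc e, he.eq, ← mul_assoc, ← hs.eq, mul_assoc, Units.mul_inv,
        mul_one]
    have hz' : Commute (1 - e) (z : R) := (Commute.one_left _).sub_left hz
    have h₂ : (1 - e) * z * ((1 - e) * ↑z⁻¹) = 1 - e := by
      rw [hz'.eq, mul_assoc, ← mul_assoc (1 - e), he.one_sub.eq, ← mul_assoc, ← hz'.eq, mul_assoc,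
        Units.mul_inv, mul_one]
    have h₃ : e * s * ((1 - e) * ↑z⁻¹) = 0 := by
      rw [hs.eq, mul_assoc, ← mul_assoc e, he.mul_one_sub_self, zero_mul, mul_zero]
    have h₄ : (1 - e) * z * (e * ↑s⁻¹) = 0 := by
      rw [hz'.eq, mul_assoc, ← mul_assoc (1 - e), he.one_sub_mul_self, zero_mul, mul_zero]
    rw [add_mul, mul_add, mul_add, h₁, h₂, h₃, h₄]
    abel
  refine ⟨⟨_, e * ↑s⁻¹ + (1 - e) * ↑z⁻¹, key s z hes hez, ?_⟩, rfl⟩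
  simpa using key s⁻¹ z⁻¹ hes.units_inv_right hez.units_inv_right

/-- On the block of `e` the element `g` vanishes and only $-t$ remains; on the block of `1 - e`, `g`
agrees with the invertible `g + e`. Hence $g-t=e(-t)+(1-e)((g+e)-t)$, tensor signs omitted. -/
theorem isUnit_ctmul_sub_of_idempotent {g e g' : A} {t t' : B} (he : IsIdempotentElem e)
    (heg : e * g = 0) (hge : g * e = 0) (h : (g + e) * g' = 1) (h' : g' * (g + e) = 1)
    (ht : t * t' = 1) (ht' : t' * t = 1) (hlt : ‖g'‖ * ‖t‖ < 1) :
    IsUnit (ctmul k g (1 : B) - ctmul k (1 : A) t) := by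
  have hz := isUnit_ctmul_sub_of_left (k := k) h h' hlt
  have hs : IsUnit (-ctmul k (1 : A) t) := (isUnit_ctmul_right ht ht').neg
  have hE : IsIdempotentElem (ctmul k e (1 : B)) := by
    rw [IsIdempotentElem, ctmul_mul, he.eq, mul_one]
  have hct : Commute (ctmul k e (1 : B)) (ctmul k (1 : A) t) := by
    simp [Commute, SemiconjBy, ctmul_mul]
  have hcg : Commute (ctmul k e (1 : B)) (ctmul k (g + e) (1 : B)) := by
    simp [Commute, SemiconjBy, ctmul_mul, mul_add, add_mul, heg, hge]
  convert isUnit_of_isIdempotentElem hE hs hz hct.neg_right (hcg.sub_right hct) using 1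
  have hee : ctmul k e (1 : B) * ctmul k (g + e) (1 : B) = ctmul k e (1 : B) := by
    rw [ctmul_mul, mul_add, heg, zero_add, he.eq, mul_one]
  rw [sub_mul, mul_sub (ctmul k e 1), hee, ctmul_add_left, one_mul, mul_neg]
  abel

/-- By density the inverse is replaced by an element of the algebraic tensor product, a finite sum,
at the cost of an error of norm less than $1$. -/
theorem exists_tensorNorm_mul_sub_one_lt {f : A} {t : B}
    (h : IsUnit (ctmul k f (1 : B) - ctmul k (1 : A) t)) :
    ∃ φ : A ⊗[k] B, tensorNorm ((f ⊗ₜ[k] (1 : B) - (1 : A) ⊗ₜ[k] t) * φ - 1) < 1 := by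
  obtain ⟨g, hg⟩ := h.exists_right_inv
  set u := ctmul k f (1 : B) - ctmul k (1 : A) t with hu
  have hopen : IsOpen {y : CTensor k A B | ‖u * y - 1‖ < 1} :=
    isOpen_lt (by fun_prop) (by fun_prop)
  obtain ⟨y, hy⟩ := UniformSpace.Completion.denseRange_coe.exists_mem_open hopen
    ⟨g, by simp [hg]⟩
  refine ⟨(toNTensor k A B).symm y, ?_⟩
  rw [← NNReal.coe_lt_coe, ← norm_toNTensor, map_sub, map_mul, map_sub, map_one,
    RingEquiv.apply_symm_apply, ← UniformSpace.Completion.norm_coe]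
  rw [Set.mem_ofPred_eq, hu, ctmul, ctmul, ← UniformSpace.Completion.coe_sub,
    ← UniformSpace.Completion.coe_mul, ← UniformSpace.Completion.coe_one,
    ← UniformSpace.Completion.coe_sub] at hy
  exact hy

/-- Here `ℓ` is an eigenvector of the transpose of left multiplication by `f`; after extending
scalars to `B`, the eigenvalue `c` stands in for `f`. -/
theorem lid_rTensor_mul (ℓ : A →ₗ[k] k) {f : A} {c : k} (hf : ∀ a, ℓ (f * a) = c * ℓ a) (t : B)
    (φ : A ⊗[k] B) :
    TensorProduct.lid k B (ℓ.rTensor B ((f ⊗ₜ[k] (1 : B) - (1 : A) ⊗ₜ[k] t) * φ)) =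
      (algebraMap k B c - t) * TensorProduct.lid k B (ℓ.rTensor B φ) := by
  induction φ using TensorProduct.induction_on with
  | zero => simp
  | add φ ψ hφ hψ => rw [mul_add, map_add, map_add, hφ, hψ, map_add, map_add, mul_add]
  | tmul a b =>
    rw [sub_mul, Algebra.TensorProduct.tmul_mul_tmul, Algebra.TensorProduct.tmul_mul_tmul, map_sub,
      map_sub, LinearMap.rTensor_tmul, LinearMap.rTensor_tmul, LinearMap.rTensor_tmul,
      TensorProduct.lid_tmul, TensorProduct.lid_tmul, TensorProduct.lid_tmul, hf, one_mul, one_mul,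
      sub_mul, ← Algebra.smul_def, mul_smul_comm, mul_smul]

end Tensor

/-! ### Diagonal operators on Laurent series -/

section Diagonal

variable {k : Type*} [NormedField k] (r : Set.Ioo (0 : ℝ) 1)

variable (k) in
/-- The coefficient of `S ^ n`. -/
def lcoeff (n : ℤ) : Laurent k r →ₗ[k] k where
  toFun f := (toSeries k r f).coeff n
  map_add' _ _ := rfl
  map_smul' _ _ := rfl

theorem lcoeff_ext {f g : Laurent k r} (h : ∀ n, lcoeff k r n f = lcoeff k r n g) : f = g :=
  HahnSeries.ext (funext h)

variable (k) in
/-- The monomial `S ^ n`. -/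
def monomial (n : ℤ) : Laurent k r := (toSeries k r).symm (HahnSeries.single n 1)

theorem lcoeff_monomial (n : ℤ) : lcoeff k r n (monomial k r n) = 1 :=
  HahnSeries.coeff_single_same n 1

theorem norm_monomial (n : ℤ) : ‖monomial k r n‖ = (r : ℝ) ^ n := by
  rw [norm_laurent_def, laurentAbs]
  simp [monomial]

theorem zpow_le_norm {f : Laurent k r} {n : ℤ} (h : lcoeff k r n f ≠ 0) : (r : ℝ) ^ n ≤ ‖f‖ := by
  have hf : toSeries k r f ≠ 0 := fun h0 => h (by
    change (toSeries k r f).coeff n = 0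
    rw [h0, HahnSeries.coeff_zero])
  rw [norm_laurent_def, laurentAbs, if_neg hf]
  exact zpow_le_zpow_right_of_le_one₀ r.2.1 r.2.2.le (HahnSeries.order_le_of_coeff_ne_zero h)

variable [IsTriviallyValued k]

/-- The operator multiplying the coefficient of `S ^ n` by `d n` for all `n`. -/
def diag (d : ℤ → k) : BoundedEnd k (Laurent k r) :=
  ⟨{ toFun := fun f => (toSeries k r).symm
      ⟨fun n => d n * (toSeries k r f).coeff n,
        (toSeries k r f).isPWO_support.mono fun n h => right_ne_zero_of_mul h⟩
     map_add' := fun f g => lcoeff_ext r fun n => mul_add _ _ _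
     map_smul' := fun a f => lcoeff_ext r fun n => mul_left_comm _ _ _ }, 1, zero_le_one,
    fun f => by
      rw [one_mul, norm_laurent_def, norm_laurent_def]
      refine laurentAbs_le_of_coeff r _ _ fun n h => ?_
      exact mul_eq_zero_of_right _ h⟩

theorem boundedEnd_ext {φ ψ : BoundedEnd k (Laurent k r)}
    (h : ∀ n f, lcoeff k r n (φ.1 f) = lcoeff k r n (ψ.1 f)) : φ = ψ :=
  Subtype.ext (LinearMap.ext fun f => lcoeff_ext r fun n => h n f)

theorem diag_mul (d d' : ℤ → k) : diag r d * diag r d' = diag r (d * d') :=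
  boundedEnd_ext r fun n f => (mul_assoc (d n) (d' n) (lcoeff k r n f)).symm

theorem diag_add (d d' : ℤ → k) : diag r d + diag r d' = diag r (d + d') :=
  boundedEnd_ext r fun n f => (add_mul (d n) (d' n) (lcoeff k r n f)).symm

theorem diag_one : diag r (1 : ℤ → k) = 1 :=
  boundedEnd_ext r fun n f => one_mul (lcoeff k r n f)

theorem diag_zero : diag r (0 : ℤ → k) = 0 :=
  boundedEnd_ext r fun n f => zero_mul (lcoeff k r n f)

theorem sdds_eq_diag : sdds k r = diag r fun n => (n : k) :=
  boundedEnd_ext r fun n f => coeff_sddsLin (toSeries k r f) n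

theorem sdds_sub_algebraMap (a : k) :
    sdds k r - algebraMap k _ a = diag r fun n => (n : k) - a := by
  rw [sdds_eq_diag, sub_eq_iff_eq_add]
  exact boundedEnd_ext r fun n f => by
    change (n : k) * lcoeff k r n f = (n - a) * lcoeff k r n f + a * lcoeff k r n f
    ring

/-- A diagonal operator cannot enlarge the support of a series, and the norm depends only on the
order. So inverting nonzero diagonal entries costs nothing in norm. -/
theorem norm_diag_le (d : ℤ → k) : ‖diag r d‖ ≤ 1 :=
  opNorm_le _ zero_le_one fun f => by
    rw [one_mul, norm_laurent_def, norm_laurent_def]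
    exact laurentAbs_le_of_coeff r _ _ fun n h => mul_eq_zero_of_right _ h

variable (k) in
/-- The diagonal matrix coefficient of index `n` of a bounded operator on `k((S))`. -/
def diagCoeff (n : ℤ) : BoundedEnd k (Laurent k r) →ₗ[k] k where
  toFun φ := lcoeff k r n (φ.1 (monomial k r n))
  map_add' φ ψ := map_add (lcoeff k r n) (φ.1 _) (ψ.1 _)
  map_smul' a φ := map_smul (lcoeff k r n) a (φ.1 _)

/-- If the coefficient is nonzero it has norm $1$, and $\varphi(S^n)$ has norm at least $r^n=|S^n|$,
which forces $\|\varphi\|\ge1$. -/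
theorem norm_diagCoeff_le (n : ℤ) (φ : BoundedEnd k (Laurent k r)) : ‖diagCoeff k r n φ‖ ≤ ‖φ‖ := by
  by_cases h : diagCoeff k r n φ = 0
  · rw [h, norm_zero]; exact norm_nonneg _
  rw [IsTriviallyValued.norm_eq_one _ h]
  have h₁ : (r : ℝ) ^ n ≤ ‖φ‖ * (r : ℝ) ^ n := by
    rw [← norm_monomial (k := k)]
    refine le_trans ?_ (le_opNorm φ (monomial k r n))
    rw [norm_monomial]
    exact zpow_le_norm r h
  exact le_of_mul_le_mul_right (by rwa [one_mul]) (zpow_pos r.2.1 n)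

theorem diagCoeff_sdds_mul (n : ℤ) (φ : BoundedEnd k (Laurent k r)) :
    diagCoeff k r n (sdds k r * φ) = (n : k) * diagCoeff k r n φ := by
  rw [sdds_eq_diag]
  rfl

end Diagonal

/-! ### The spectrum of `S d/dS` -/

section Spectrum

variable {k : Type*} [NormedField k] [IsTriviallyValued k] (r : Set.Ioo (0 : ℝ) 1)
  (x : AffineLine k)

/-- The diagonal matrix coefficient of index `n`, with scalars extended to `ℋ(x)`. -/
def diagCoeffH (n : ℤ) : BoundedEnd k (Laurent k r) ⊗[k] x.H →ₗ[k] x.H :=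
  TensorProduct.lid k x.H ∘ₗ (diagCoeff k r n).rTensor x.H

theorem diagCoeffH_tmul (n : ℤ) (φ : BoundedEnd k (Laurent k r)) (h : x.H) :
    diagCoeffH r x n (φ ⊗ₜ[k] h) = diagCoeff k r n φ • h := by
  simp [diagCoeffH]

/-- The tensor seminorm uses maxima rather than sums, so the ultrametric inequality in $\mathscr
H(x)$ is what preserves the constant $1$. -/
theorem norm_diagCoeffH_le (n : ℤ) (f : BoundedEnd k (Laurent k r) ⊗[k] x.H) :
    ‖diagCoeffH r x n f‖₊ ≤ tensorNorm f := by
  refine le_of_forall_gt_imp_ge_of_dense fun ε hε => ?_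
  obtain ⟨m, a, b, rfl, h⟩ := exists_rep_lt f hε
  rw [map_sum]
  refine IsUltrametricDist.nnnorm_sum_le_of_forall_le fun i _ => ?_
  refine le_trans ?_ (h i)
  rw [diagCoeffH_tmul, ← NNReal.coe_le_coe, NNReal.coe_mul, coe_nnnorm, coe_nnnorm, coe_nnnorm,
    x.norm_smul_H]
  gcongr
  exact norm_diagCoeff_le r n _

theorem diagCoeffH_mul (n : ℤ) (f : BoundedEnd k (Laurent k r) ⊗[k] x.H) :
    diagCoeffH r x n ((sdds k r ⊗ₜ[k] (1 : x.H) - 1 ⊗ₜ[k] x.coord) * f) =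
      (algebraMap k x.H n - x.coord) * diagCoeffH r x n f := by
  exact lid_rTensor_mul (diagCoeff k r n) (diagCoeff_sdds_mul r n) x.coord f

theorem diagCoeffH_one (n : ℤ) :
    diagCoeffH r x n (1 : BoundedEnd k (Laurent k r) ⊗[k] x.H) = 1 := by
  rw [Algebra.TensorProduct.one_def, diagCoeffH_tmul,
    show diagCoeff k r n 1 = 1 from lcoeff_monomial r n, one_smul]

/-! ### Points that belong to the spectrum -/

/-- The point is uniformity: a single finite tensor `f` serves all `n` at once. -/
theorem exists_forall_norm_lt_one (h : x ∉ berkovichSpectrum k (sdds k r)) :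
    ∃ f : BoundedEnd k (Laurent k r) ⊗[k] x.H, ∀ n : ℤ,
      ‖(algebraMap k x.H n - x.coord) * diagCoeffH r x n f - 1‖ < 1 := by
  obtain ⟨f, hf⟩ := exists_tensorNorm_mul_sub_one_lt (not_not.1 h)
  refine ⟨f, fun n => ?_⟩
  have := (norm_diagCoeffH_le r x n _).trans_lt hf
  rwa [map_sub, diagCoeffH_mul, diagCoeffH_one] at this

theorem gaussPoint_intCast_mem (n : ℤ) :
    AffineLine.gaussPoint (n : k) 0 ∈ berkovichSpectrum k (sdds k r) := by
  by_contra h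
  obtain ⟨f, hf⟩ := exists_forall_norm_lt_one r _ h
  have h0 : ‖(AffineLine.gaussPoint (n : k) 0).coord - algebraMap k _ (n : k)‖ = 0 := by
    rw [AffineLine.norm_coord_sub, AffineLine.gaussPoint_zero_right_apply]
    simp
  have := hf n
  -- At this point $T(x)=n$, so the error is exactly $-1$, of norm $1$.
  rw [← sub_eq_zero.1 (norm_eq_zero.1 h0), sub_self, zero_mul, zero_sub, norm_neg, norm_one] at this
  exact lt_irrefl _ this

theorem mem_spectrum_of_forall_eq_one [CharZero k] (hx : ∀ p ≠ 0, x.seminorm p = 1) :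
    x ∈ berkovichSpectrum k (sdds k r) := by
  by_contra h
  obtain ⟨f, hf⟩ := exists_forall_norm_lt_one r x h
  have hval : ∀ p, x.seminorm p = 0 ∨ x.seminorm p = 1 := fun p => by
    by_cases hp : p = 0
    · exact Or.inl (by rw [hp, map_zero])
    · exact Or.inr (hx p hp)
  have htr : Transcendental k x.coord := x.transcendental_coord fun p hp => by
    rw [hx p hp]; exact one_ne_zero
  have hcoeff : ∀ n : ℤ, (x.coord - algebraMap k x.H n)⁻¹ = -diagCoeffH r x n f := fun n => by
    have h1 := sub_eq_zero.1 (x.eq_zero_of_norm_lt_one hval (hf n))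
    refine inv_eq_of_mul_eq_one_right ?_
    rw [mul_neg, ← neg_mul, neg_sub, h1]
  -- Only the finiteness of the representation matters; the bound is arbitrary.
  obtain ⟨m, a, b, rfl, -⟩ := exists_rep_lt f (lt_add_one _)
  -- Partial fractions with distinct poles are independent because $T(x)$ is transcendental;
  -- characteristic $0$ keeps the integers distinct in `k`.
  have hli : LinearIndependent k fun n : ℤ => (x.coord - algebraMap k x.H n)⁻¹ :=
    htr.linearIndependent_sub_inv.comp _ Int.cast_injective
  have hmem : ∀ n : ℤ, (x.coord - algebraMap k x.H n)⁻¹ ∈ Submodule.span k (Set.range b) :=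
    fun n => by
      rw [hcoeff, map_sum]
      refine neg_mem (sum_mem fun i _ => ?_)
      rw [diagCoeffH_tmul]
      exact Submodule.smul_mem _ _ (Submodule.subset_span ⟨i, rfl⟩)
  have hfin : FiniteDimensional k (Submodule.span k (Set.range b)) :=
    FiniteDimensional.span_of_finite k (Set.finite_range b)
  have hli' : LinearIndependent k fun n : ℤ =>
      (⟨_, hmem n⟩ : Submodule.span k (Set.range b)) :=
    LinearIndependent.of_comp (Submodule.span k (Set.range b)).subtype hli
  exact Infinite.not_finite (α := ℤ) hli'.finite

theorem gaussPoint_zero_one_mem [IsAlgClosed k] [CharZero k] :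
    AffineLine.gaussPoint (0 : k) 1 ∈ berkovichSpectrum k (sdds k r) :=
  mem_spectrum_of_forall_eq_one r _ fun _ hp => AffineLine.gaussPoint_zero_one_of_ne_zero hp

/-! ### Points outside the spectrum -/

theorem notMem_spectrum_of_one_lt (h : 1 < x.seminorm Polynomial.X) :
    x ∉ berkovichSpectrum k (sdds k r) := by
  have h1 : 1 < ‖x.coord‖ := by rw [x.norm_coord]; exact_mod_cast h
  have h0 : x.coord ≠ 0 := norm_pos_iff.1 (zero_lt_one.trans h1)
  refine not_not.2 (isUnit_ctmul_sub_of_right (mul_inv_cancel₀ h0) (inv_mul_cancel₀ h0) ?_)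
  rw [norm_inv, sdds_eq_diag]
  calc _ ≤ 1 * ‖x.coord‖⁻¹ := by gcongr; exact norm_diag_le r _
    _ < 1 := by rw [one_mul]; exact inv_lt_one_of_one_lt₀ h1

theorem notMem_spectrum_of_forall_ne {a : k} (ha : ∀ n : ℤ, (n : k) ≠ a)
    (h : x.seminorm (Polynomial.X - Polynomial.C a) < 1) :
    x ∉ berkovichSpectrum k (sdds k r) := by
  refine not_not.2 ?_
  rw [ctmul_sub_ctmul_translate _ _ a, sdds_sub_algebraMap]
  have hd : (fun n : ℤ => (n : k) - a) * (fun n : ℤ => ((n : k) - a)⁻¹) = 1 :=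
    funext fun n => mul_inv_cancel₀ (sub_ne_zero.2 (ha n))
  refine isUnit_ctmul_sub_of_left (g' := diag r fun n : ℤ => ((n : k) - a)⁻¹) ?_ ?_ ?_
  · rw [diag_mul, hd, diag_one]
  · rw [diag_mul, mul_comm, hd, diag_one]
  · rw [x.norm_coord_sub]
    calc _ ≤ 1 * (x.seminorm (Polynomial.X - Polynomial.C a) : ℝ) := by
          gcongr; exact norm_diag_le r _
      _ < 1 := by rw [one_mul]; exact_mod_cast h

theorem notMem_spectrum_of_intCast [CharZero k] {m : ℤ}
    (h0 : x.seminorm (Polynomial.X - Polynomial.C (m : k)) ≠ 0)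
    (h : x.seminorm (Polynomial.X - Polynomial.C (m : k)) < 1) :
    x ∉ berkovichSpectrum k (sdds k r) := by
  refine not_not.2 ?_
  rw [ctmul_sub_ctmul_translate _ _ (m : k), sdds_sub_algebraMap]
  have ht : x.coord - algebraMap k x.H m ≠ 0 := by
    rw [← norm_ne_zero_iff, x.norm_coord_sub]
    exact_mod_cast h0
  have hd : (fun n : ℤ => (n : k) - m) * Pi.single m 1 = 0 := by
    funext n
    by_cases hn : n = m
    · subst hn; simp
    · simp [hn]
  -- The added term replaces the only zero eigenvalue, at $n=m$, by $1$; the others are nonzero in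
  -- characteristic $0$.
  have hi : ((fun n : ℤ => (n : k) - m) + Pi.single m 1) *
      ((fun n : ℤ => (n : k) - m) + Pi.single m 1)⁻¹ = 1 := by
    funext n
    refine mul_inv_cancel₀ ?_
    by_cases hn : n = m
    · subst hn; simp
    · simp [hn, sub_eq_zero]
  refine isUnit_ctmul_sub_of_idempotent (e := diag r (Pi.single m 1))
    (g' := diag r ((fun n : ℤ => (n : k) - m) + Pi.single m 1)⁻¹) ?_ ?_ ?_ ?_ ?_
    (mul_inv_cancel₀ ht) (inv_mul_cancel₀ ht) ?_
  · rw [IsIdempotentElem, diag_mul, ← Pi.single_mul, mul_one]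
  · rw [diag_mul, mul_comm, hd, diag_zero]
  · rw [diag_mul, hd, diag_zero]
  · rw [diag_add, diag_mul, hi, diag_one]
  · rw [diag_add, diag_mul, mul_comm, hi, diag_one]
  · rw [x.norm_coord_sub]
    calc _ ≤ 1 * (x.seminorm (Polynomial.X - Polynomial.C (m : k)) : ℝ) := by
          gcongr; exact norm_diag_le r _
      _ < 1 := by rw [one_mul]; exact_mod_cast h

end Spectrum

end BerkovichSpectrum

end

theorem mainTheorem3 (k : Type*) [NormedField k] [BerkovichSpectrum.IsTriviallyValued k]
    [IsAlgClosed k] [CharZero k] (r : Set.Ioo (0 : ℝ) 1) :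
    BerkovichSpectrum.berkovichSpectrum k (BerkovichSpectrum.sdds k r) =
      Set.range (fun n : ℤ => BerkovichSpectrum.AffineLine.gaussPoint (n : k) 0) ∪
        {BerkovichSpectrum.AffineLine.gaussPoint (0 : k) 1} := by
  open BerkovichSpectrum in
  refine Set.Subset.antisymm (fun x hx => ?_) (Set.union_subset ?_ ?_)
  · have hX : x.seminorm Polynomial.X ≤ 1 :=
      not_lt.1 fun h => notMem_spectrum_of_one_lt r x h hx
    by_cases hall : ∀ a : k, x.seminorm (Polynomial.X - Polynomial.C a) = 1
    · exact Or.inr (AffineLine.eq_gaussPoint_zero_one hall)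
    obtain ⟨a, ha⟩ := not_forall.1 hall
    have hlt := lt_of_le_of_ne (x.seminorm_X_sub_C_le_one hX a) ha
    -- Now `x` lies in the open unit disc around `a`; such a point survives only if `a` is an
    -- integer and `x` is the centre itself.
    by_cases hn : ∀ n : ℤ, (n : k) ≠ a
    · exact absurd hx (notMem_spectrum_of_forall_ne r x hn hlt)
    push Not at hn
    obtain ⟨n, rfl⟩ := hn
    have h0 : x.seminorm (Polynomial.X - Polynomial.C (n : k)) = 0 := by
      by_contra h0
      exact notMem_spectrum_of_intCast r x h0 hlt hx
    exact Or.inl ⟨n, (AffineLine.eq_gaussPoint_zero_right h0).symm⟩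
  · rintro _ ⟨n, rfl⟩
    exact gaussPoint_intCast_mem r n
  · rintro _ rfl
    exact gaussPoint_zero_one_mem r
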